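/- Let $p\ge 2$ be an integer and let $V:\mathbb Z\to\mathbb R$ be $p$-periodic and non-degenerate, i.e. with gap $\gamma:=\min_{0<|j-k|<p}|V_j-V_k|>0$, and let $\Gamma:=\max_{0<|j-k|<p}|V_j-V_k|$ be its range. For $\mu>0$ let $H_\mu=\Delta+\mu V$ on $\ell^2(\mathbb Z)$, that is, $(H_\mu\psi)(n)=\psi(n+1)+\psi(n-1)+\mu V_n\psi(n)$. Identify $\ell^2(\mathbb Z)$ with $\mathbb C^p\otimes\ell^2(\mathbb Z)$ through $\delta_{pj+m-1}=e_m\otimes|j\rangle$ ($1\le m\le p$, $j\in\mathbb Z$), and for $j,k\in\mathbb Z$ let $e^{-itH_\mu}(j,k)\in\mathbb C^{p\times p}$ be the $(j,k)$-th block of $e^{-itH_\mu}$, with entries $\langle\delta_{pj+m-1},e^{-itH_\mu}\delta_{pk+n-1}\rangle$, $1\le m,n\le p$. Then for every $\eta_0>0$ there are constants $C_1>0$, $C_2$ and $\mu_0$, depending only on $\eta_0,\gamma,\Gamma,p$, such that $$\left\|e^{-itH_\mu}(j,k)\right\|\le C_1\exp\left(-\eta_0\left(|j-k|-\frac{C_2}{\mu}|t|\right)\right)\qquad\text{for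 all }t\in\mathbb R,\ j,k\in\mathbb Z,\ \mu\ge\mu_0,$$ where $\|\cdot\|$ is the operator norm on $\mathbb C^p$ with its Euclidean norm. Moreover one can take $$C_2=\frac{\hat C}{\eta_0(\gamma/2)^{p-1}},\qquad \mu_0=\left(\max\left\{1,\,2\hat C(2/\gamma)^p\right\}\right)^{1/2},$$ $$\hat C=2^p(\Gamma+\gamma/2)^p+(\Gamma+\gamma/2+2)^{p-2}+2e^{\eta_0}+\frac{1}{2e^{\eta_0}}.$$ -/

import Mathlib

open scoped lp ENNReal

noncomputable section

namespace LiebRobinson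

/-- The discrete line Hilbert space `ℓ²(ℤ)`. -/
abbrev L2Z : Type := ℓ²(ℤ, ℂ)

/-- A sequence translated by `a` is still square summable. -/
theorem memlp_translate (a : ℤ) (ψ : L2Z) : Memℓp (fun n : ℤ => ψ (n + a)) 2 := by
  have h := (lp.memℓp ψ).summable (by norm_num)
  exact memℓp_gen ((Equiv.addRight a).summable_iff.2 h)

/-- Translation `(translate a ψ)(n) = ψ(n + a)`, as a bounded operator on `ℓ²(ℤ)`. -/
def translate (a : ℤ) : L2Z →L[ℂ] L2Z :=
  LinearMap.mkContinuous
    { toFun := fun ψ => (⟨fun n : ℤ => ψ (n + a), memlp_translate a ψ⟩ : L2Z)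
      map_add' := fun _ _ => by ext; rfl
      map_smul' := fun _ _ => by ext; rfl }
    1 (fun ψ => by
      have hp : 0 < (2 : ℝ≥0∞).toReal := by norm_num
      rw [one_mul]
      refine le_of_eq ?_
      rw [lp.norm_eq_tsum_rpow hp, lp.norm_eq_tsum_rpow hp]
      congr 1
      exact (Equiv.addRight a).tsum_eq (fun n : ℤ => ‖ψ n‖ ^ (2 : ℝ≥0∞).toReal))

@[simp]
theorem translate_apply (a : ℤ) (ψ : L2Z) (n : ℤ) : translate a ψ n = ψ (n + a) := rfl

/-- The discrete Laplacian `(Δψ)(n) = ψ(n + 1) + ψ(n - 1)`. -/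
def laplacian : L2Z →L[ℂ] L2Z := translate 1 + translate (-1)

/-- Multiplication by a bounded real potential, `(V ψ)(n) = V n * ψ(n)`. -/
def potentialOp (V : ℤ → ℝ) (hb : BddAbove (Set.range fun n => |V n|)) : L2Z →L[ℂ] L2Z :=
  lp.mapCLM 2 (fun n : ℤ => ((V n : ℂ) • ContinuousLinearMap.id ℂ ℂ))
    (K := ⨆ n, |V n|) (Real.iSup_nonneg fun _ => abs_nonneg _)
    (fun n => by
      rw [norm_smul, ContinuousLinearMap.norm_id, mul_one, Complex.norm_real, Real.norm_eq_abs]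
      exact le_ciSup hb n)

/-- A periodic potential is bounded. -/
theorem bddAbove_of_periodic {p : ℕ} (hp : 0 < p) {V : ℤ → ℝ}
    (hV : Function.Periodic V (p : ℤ)) : BddAbove (Set.range fun n => |V n|) := by
  have hp' : (0 : ℤ) < p := by exact_mod_cast hp
  refine (((Set.finite_Ico (0 : ℤ) p).image fun n => |V n|).subset ?_).bddAbove
  rintro _ ⟨n, rfl⟩
  refine ⟨n % p, ⟨Int.emod_nonneg _ hp'.ne', Int.emod_lt_of_pos _ hp'⟩, ?_⟩
  have h := hV.sub_zsmul_eq (x := n) (n / p)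
  have h2 : n - (n / (p : ℤ)) • (p : ℤ) = n % p := by
    rw [smul_eq_mul, Int.emod_def, mul_comm]
  rw [h2] at h
  simp only [h]

/-- The Schrödinger operator `H_μ = Δ + μ V` on `ℓ²(ℤ)`, for a bounded potential `V`. -/
def hamiltonian (μ : ℝ) (V : ℤ → ℝ) (hb : BddAbove (Set.range fun n => |V n|)) :
    L2Z →L[ℂ] L2Z :=
  laplacian + (μ : ℂ) • potentialOp V hb

theorem hamiltonian_apply (μ : ℝ) (V : ℤ → ℝ) (hb : BddAbove (Set.range fun n => |V n|))
    (ψ : L2Z) (n : ℤ) :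
    hamiltonian μ V hb ψ n = ψ (n + 1) + ψ (n - 1) + (μ : ℂ) * ((V n : ℂ) * ψ n) := by
  have h : potentialOp V hb ψ n = (V n : ℂ) * ψ n := rfl
  rw [← h, sub_eq_add_neg]
  rfl

/-- The unitary group `e^{-itH}` generated by a bounded operator `H` (for `H` self-adjoint). -/
def evolution (H : L2Z →L[ℂ] L2Z) (t : ℝ) : L2Z →L[ℂ] L2Z :=
  NormedSpace.exp ((-(Complex.I * (t : ℂ))) • H)

/-- The canonical basis vector `δ_n` of `ℓ²(ℤ)`. -/
def delta (n : ℤ) : L2Z := lp.single 2 n (1 : ℂ)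

/-- The `(j,k)`-th `p × p` block of an operator under `ℓ²(ℤ) ≅ ℂ^p ⊗ ℓ²(ℤ)`, where `δ_{pj+m}`
corresponds to `e_m ⊗ |j⟩`, `m = 0, …, p - 1`. -/
def block (p : ℕ) (T : L2Z →L[ℂ] L2Z) (j k : ℤ) : Matrix (Fin p) (Fin p) ℂ :=
  Matrix.of fun m n => inner ℂ (delta (p * j + (m : ℕ))) (T (delta (p * k + (n : ℕ))))

/-- The operator norm of a matrix acting on `ℂ^p` with its Euclidean norm. -/
def matrixOpNorm {p : ℕ} (M : Matrix (Fin p) (Fin p) ℂ) : ℝ :=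
  ‖Matrix.toEuclideanCLM (n := Fin p) (𝕜 := ℂ) M‖

/-- The set of distances `|V_j - V_k|`, `0 < |j - k| < p`. Its minimum is the gap of `V`, its
maximum is the range of `V`. -/
def distances (p : ℕ) (V : ℤ → ℝ) : Set ℝ :=
  {d | ∃ j k : ℤ, 0 < |j - k| ∧ |j - k| < p ∧ d = |V j - V k|}

/-- `Ĉ = 2^p (Γ + γ/2)^p + (Γ + γ/2 + 2)^(p-2) + 2 e^{η₀} + 1 / (2 e^{η₀})`. -/
def hatC (η₀ γ Γ : ℝ) (p : ℕ) : ℝ :=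
  2 ^ p * (Γ + γ / 2) ^ p + (Γ + γ / 2 + 2) ^ (p - 2) + 2 * Real.exp η₀ + 1 / (2 * Real.exp η₀)

end LiebRobinson

end

namespace LiebRobinson

/-! Conjugating `H_μ` by the weight `α ^ n` (Combes–Thomas) multiplies the matrix element of the
evolution at `(m, n)` by a power of `α`, so off-diagonal decay follows from a norm bound on the
evolution of the conjugated, non-self-adjoint operator `A + μ V`. A crude bound would give a growth
rate of order one. Neighbouring values of `V` differ by at least `γ`, so the hopping `A` is a
commutator with `V`: `[V, X] = -A` with `X` bounded. Conjugating by `1 + X / μ` therefore cancels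
`A` and leaves `μ V + O(1/μ)`. As `μ V` is symmetric, only the remainder causes growth, at rate
`O(|t|/μ)` (`norm_exp_le_of_commutator`). The rest is comparison with the explicit constants. -/

/-! ### Growth of evolutions with non-self-adjoint generators -/

/-- If the numerical range of `G` lies in the half plane `re z ≤ b`, then `‖e^G‖ ≤ e^b`. -/
theorem norm_exp_le_of_re_inner_le {E : Type*} [NormedAddCommGroup E] [InnerProductSpace ℂ E]
    [CompleteSpace E] (G : E →L[ℂ] E) (b : ℝ)
    (h : ∀ u : E, (inner ℂ u (G u)).re ≤ b * ‖u‖ ^ 2) :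
    ‖NormedSpace.exp G‖ ≤ Real.exp b := by
  refine ContinuousLinearMap.opNorm_le_bound _ (Real.exp_pos b).le fun ψ => ?_
  let u : ℝ → E := fun s => NormedSpace.exp (s • G) ψ
  have hu : ∀ s, HasDerivAt u (G (u s)) s := fun s => by
    have h1 := hasDerivAt_exp_smul_const' (𝕂 := ℝ) G s
    exact ((ContinuousLinearMap.apply ℂ E ψ).restrictScalars ℝ).hasFDerivAt.comp_hasDerivAt s h1
  let _ : InnerProductSpace ℝ E := InnerProductSpace.rclikeToReal ℂ E
  have hu2 : ∀ s, HasDerivAt (fun s => ‖u s‖ ^ 2) (2 * (inner ℂ (u s) (G (u s))).re) s :=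
    fun s => (hu s).norm_sq
  -- Grönwall: the hypothesis makes `e^{-2bs} ‖u s‖²` nonincreasing.
  have hf : ∀ s, HasDerivAt (fun s => Real.exp (-(2 * b) * s) * ‖u s‖ ^ 2)
      (Real.exp (-(2 * b) * s) * (-(2 * b)) * ‖u s‖ ^ 2 +
        Real.exp (-(2 * b) * s) * (2 * (inner ℂ (u s) (G (u s))).re)) s := fun s => by
    have h1 := ((hasDerivAt_id s).const_mul (-(2 * b))).exp
    simp only [id, mul_one] at h1
    exact h1.mul (hu2 s)
  have hanti := antitone_of_hasDerivAt_nonpos hf fun s => by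
    have := mul_le_mul_of_nonneg_left (h (u s)) (Real.exp_pos (-(2 * b) * s)).le
    simp only [Pi.zero_apply]
    linarith
  have h01 := hanti (zero_le_one' ℝ)
  have hu0 : u 0 = ψ := by simp [u]
  have hu1 : u 1 = NormedSpace.exp G ψ := by simp [u]
  simp only [hu0, hu1, mul_zero, mul_one, Real.exp_zero, one_mul, Real.exp_neg] at h01
  rw [inv_mul_le_iff₀ (Real.exp_pos _), two_mul, Real.exp_add] at h01
  refine (sq_le_sq₀ (norm_nonneg _) (by positivity)).1 ?_
  linarith [mul_pow (Real.exp b) ‖ψ‖ 2, sq (Real.exp b)]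

/-- Bound on the inverse of a perturbation of the identity. -/
theorem norm_inv_oneSub_le {E : Type*} [NormedAddCommGroup E] [NormedSpace ℂ E] [CompleteSpace E]
    (T : E →L[ℂ] E) (hT : ‖T‖ < 1) : ‖((Units.oneSub T hT)⁻¹ : (E →L[ℂ] E)ˣ).val‖ ≤ (1 - ‖T‖)⁻¹ := by
  set S := Units.oneSub T hT
  have h1 : (S⁻¹).val = 1 + T * (S⁻¹).val := by
    have h2 : (1 - T) * (S⁻¹).val = 1 := S.mul_inv
    rw [sub_mul, one_mul, sub_eq_iff_eq_add] at h2
    exact h2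
  have h3 : ‖(S⁻¹).val‖ ≤ 1 + ‖T‖ * ‖(S⁻¹).val‖ := by
    calc ‖(S⁻¹).val‖ = ‖1 + T * (S⁻¹).val‖ := by rw [← h1]
      _ ≤ ‖(1 : E →L[ℂ] E)‖ + ‖T * (S⁻¹).val‖ := norm_add_le _ _
      _ ≤ 1 + ‖T‖ * ‖(S⁻¹).val‖ := add_le_add ContinuousLinearMap.norm_id_le (norm_mul_le _ _)
  refine (le_inv_mul_iff₀ (by linarith : 0 < 1 - ‖T‖)).2 ?_ |>.trans_eq (mul_one _)
  linarith

/-- If `A` is a commutator with the symmetric operator `D`, then `A + μ D` is similar to `μ D` up to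
an error of order `μ⁻¹`, so its evolution grows at a rate of order `μ⁻¹`. -/
theorem norm_exp_le_of_commutator {E : Type*} [NormedAddCommGroup E] [InnerProductSpace ℂ E]
    [CompleteSpace E] {A D X : E →L[ℂ] E} {a g μ : ℝ} (hμ : 0 < μ) (hg : 0 < g)
    (hD : (D : E →ₗ[ℂ] E).IsSymmetric) (hDX : D * X - X * D = -A) (hA : ‖A‖ ≤ a)
    (hX : ‖X‖ ≤ a / g) (hx : a / (g * μ) ≤ 2 / 5) (t : ℝ) :
    ‖NormedSpace.exp ((-(Complex.I * (t : ℂ))) • (A + (μ : ℂ) • D))‖ ≤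
      7 / 3 * Real.exp (5 / 3 * (a ^ 2 / (g * μ)) * |t|) := by
  have ha : 0 ≤ a := (norm_nonneg _).trans hA
  set Y : E →L[ℂ] E := (μ : ℂ)⁻¹ • X with hY
  have hμ' : (μ : ℂ) ≠ 0 := by exact_mod_cast hμ.ne'
  have hYn : ‖Y‖ ≤ a / (g * μ) := by
    rw [hY, norm_smul, norm_inv, Complex.norm_real, Real.norm_of_nonneg hμ.le,
      inv_mul_le_iff₀ hμ]
    refine hX.trans (le_of_eq ?_)
    field_simp
  have hYn' : ‖-Y‖ ≤ 2 / 5 := by rw [norm_neg]; exact hYn.trans hx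
  have hY1 : ‖-Y‖ < 1 := by linarith
  set S := Units.oneSub (-Y) hY1
  have hS : S.val = 1 + Y := sub_neg_eq_add 1 Y
  have hSn : ‖S.val‖ ≤ 7 / 5 := by
    rw [hS]
    refine (norm_add_le _ _).trans ?_
    have : ‖(1 : E →L[ℂ] E)‖ ≤ 1 := ContinuousLinearMap.norm_id_le
    linarith
  have hSin : ‖(S⁻¹).val‖ ≤ 5 / 3 := by
    refine (norm_inv_oneSub_le (-Y) hY1).trans ?_
    rw [inv_le_comm₀ (by linarith) (by norm_num)]
    linarith
  -- Since `[μ D, Y] = -A`, one has `(A + μ D)(1 + Y) = (1 + Y) μ D + A Y`; `B` is the remainder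
  -- after dividing by `S = 1 + Y`.
  set B : E →L[ℂ] E := (S⁻¹).val * (A * Y) with hB
  have hBn : ‖B‖ ≤ 5 / 3 * (a ^ 2 / (g * μ)) := by
    calc ‖B‖ ≤ ‖(S⁻¹).val‖ * (‖A‖ * ‖Y‖) :=
          (norm_mul_le _ _).trans (mul_le_mul_of_nonneg_left (norm_mul_le _ _) (norm_nonneg _))
      _ ≤ 5 / 3 * (a * (a / (g * μ))) := by gcongr
      _ = _ := by ring
  have hconj : A + (μ : ℂ) • D = S.val * ((μ : ℂ) • D + B) * (S⁻¹).val := by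
    rw [Units.eq_mul_inv_iff_mul_eq, mul_add, hB, Units.mul_inv_cancel_left, hS]
    have h1 : (μ : ℂ) • (D * Y) = (μ : ℂ) • (Y * D) - A := by
      rw [hY, mul_smul_comm, smul_mul_assoc, smul_inv_smul₀ hμ', smul_inv_smul₀ hμ',
        ← sub_eq_iff_eq_add'.1 hDX |>.symm]
      abel
    simp only [add_mul, mul_add, mul_one, one_mul, smul_mul_assoc, mul_smul_comm, h1, smul_add]
    abel
  have hexp : ‖NormedSpace.exp ((-(Complex.I * (t : ℂ))) • ((μ : ℂ) • D + B))‖ ≤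
      Real.exp (5 / 3 * (a ^ 2 / (g * μ)) * |t|) := by
    refine norm_exp_le_of_re_inner_le _ _ fun u => ?_
    -- After multiplication by `-it`, the symmetric part contributes nothing to the real part.
    have hDu : (inner ℂ u (D u)).im = 0 := by
      have := hD.im_inner_self_apply u
      simpa using this
    have h1 : (inner ℂ u (((-(Complex.I * (t : ℂ))) • ((μ : ℂ) • D + B)) u)).re =
        (-(Complex.I * (t : ℂ)) * inner ℂ u (B u)).re := by
      rw [smul_apply, add_apply, smul_apply, inner_smul_right, inner_add_right, inner_smul_right,
        mul_add, Complex.add_re]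
      simp [hDu]
    rw [h1]
    calc _ ≤ ‖-(Complex.I * (t : ℂ)) * inner ℂ u (B u)‖ := Complex.re_le_norm _
      _ = |t| * ‖inner ℂ u (B u)‖ := by simp
      _ ≤ |t| * (‖u‖ * (5 / 3 * (a ^ 2 / (g * μ)) * ‖u‖)) := by
          gcongr
          exact (norm_inner_le_norm _ _).trans
            (mul_le_mul_of_nonneg_left (B.le_of_opNorm_le hBn u) (norm_nonneg _))
      _ = _ := by ring
  let _ := NormedAlgebra.restrictScalars ℚ ℂ (E →L[ℂ] E)
  rw [hconj, ← smul_mul_assoc, ← mul_smul_comm, NormedSpace.exp_units_conj]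
  calc _ ≤ ‖S.val‖ * ‖NormedSpace.exp ((-(Complex.I * (t : ℂ))) • ((μ : ℂ) • D + B))‖ *
        ‖(S⁻¹).val‖ := norm_mul₃_le
    _ ≤ 7 / 5 * Real.exp (5 / 3 * (a ^ 2 / (g * μ)) * |t|) * (5 / 3) := by gcongr
    _ = _ := by ring

/-! ### The weighted hopping as a commutator with the potential -/

theorem norm_translate_le (a : ℤ) : ‖translate a‖ ≤ 1 :=
  LinearMap.mkContinuous_norm_le _ zero_le_one _

theorem potentialOp_apply (V : ℤ → ℝ) (hb : BddAbove (Set.range fun n => |V n|)) (ψ : L2Z)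
    (n : ℤ) : potentialOp V hb ψ n = (V n : ℂ) * ψ n := rfl

theorem norm_potentialOp_le (V : ℤ → ℝ) (hb : BddAbove (Set.range fun n => |V n|)) {c : ℝ}
    (hc : ∀ n, |V n| ≤ c) : ‖potentialOp V hb‖ ≤ c :=
  (lp.norm_mapCLM_le 2 _ _ _).trans (ciSup_le hc)

theorem potentialOp_isSymmetric (V : ℤ → ℝ) (hb : BddAbove (Set.range fun n => |V n|)) :
    (potentialOp V hb : L2Z →ₗ[ℂ] L2Z).IsSymmetric := fun u v => by
  simp only [ContinuousLinearMap.coe_coe, lp.inner_eq_tsum, potentialOp_apply]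
  refine tsum_congr fun n => ?_
  simp [RCLike.inner_apply]
  ring

/-- Hopping with weight `α` to the left and `α⁻¹` to the right: the conjugate of the Laplacian by
multiplication with `α ^ n`. -/
noncomputable def weightedHop (α : ℝ) : L2Z →L[ℂ] L2Z := (α : ℂ) • translate 1 + (α : ℂ)⁻¹ • translate (-1)

theorem norm_smul_translate_add_le {α c : ℝ} (hα : 0 < α) {P Q : L2Z →L[ℂ] L2Z}
    (hP : ‖P‖ ≤ c) (hQ : ‖Q‖ ≤ c) :
    ‖(α : ℂ) • (P * translate 1) + (α : ℂ)⁻¹ • (Q * translate (-1))‖ ≤ (α + α⁻¹) * c := by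
  have key : ∀ (b : ℤ) (R : L2Z →L[ℂ] L2Z), ‖R‖ ≤ c → ‖R * translate b‖ ≤ c := fun b R hR =>
    (norm_mul_le _ _).trans ((mul_le_of_le_one_right (norm_nonneg _) (norm_translate_le b)).trans hR)
  refine (norm_add_le _ _).trans ?_
  rw [norm_smul, norm_smul, norm_inv, Complex.norm_real, Real.norm_of_nonneg hα.le, add_mul]
  have := key 1 P hP
  have := key (-1) Q hQ
  gcongr

theorem norm_weightedHop_le {α : ℝ} (hα : 0 < α) : ‖weightedHop α‖ ≤ α + α⁻¹ := by
  have h1 : ‖(1 : L2Z →L[ℂ] L2Z)‖ ≤ 1 := ContinuousLinearMap.norm_id_le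
  simpa [weightedHop] using norm_smul_translate_add_le hα h1 h1

/-- If neighbouring values of `V` differ by at least `g`, the hopping operator is a commutator with
`V` of an operator of norm at most `(α + α⁻¹) / g`. -/
theorem exists_commutator_eq_neg_weightedHop {α g : ℝ} (hα : 0 < α) (hg : 0 < g) (V : ℤ → ℝ)
    (hb : BddAbove (Set.range fun n => |V n|)) (hV : ∀ n, g ≤ |V n - V (n + 1)|) :
    ∃ X : L2Z →L[ℂ] L2Z, ‖X‖ ≤ (α + α⁻¹) / g ∧
      potentialOp V hb * X - X * potentialOp V hb = -weightedHop α := by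
  have hne : ∀ n, V n - V (n + 1) ≠ 0 := fun n h => by
    have := hV n
    rw [h, abs_zero] at this
    linarith
  -- Solves `[V, X] = -A` entrywise: each hopping entry is divided by minus the difference of the
  -- two potential values it joins.
  let W : ℤ → ℝ := fun n => -(V n - V (n + 1))⁻¹
  let W' : ℤ → ℝ := fun n => (V (n - 1) - V n)⁻¹
  have hW : ∀ n, |W n| ≤ g⁻¹ := fun n => by
    simp only [W, abs_neg, abs_inv]
    exact inv_anti₀ hg (hV n)
  have hW' : ∀ n, |W' n| ≤ g⁻¹ := fun n => by
    simp only [W', abs_inv]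
    have := hV (n - 1)
    rw [sub_add_cancel] at this
    exact inv_anti₀ hg this
  have hbW : BddAbove (Set.range fun n => |W n|) := ⟨g⁻¹, by rintro _ ⟨n, rfl⟩; exact hW n⟩
  have hbW' : BddAbove (Set.range fun n => |W' n|) := ⟨g⁻¹, by rintro _ ⟨n, rfl⟩; exact hW' n⟩
  refine ⟨(α : ℂ) • (potentialOp W hbW * translate 1) +
    (α : ℂ)⁻¹ • (potentialOp W' hbW' * translate (-1)),
    norm_smul_translate_add_le hα (norm_potentialOp_le W hbW hW) (norm_potentialOp_le W' hbW' hW'),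
    ?_⟩
  ext ψ n
  change (V n : ℂ) * ((α : ℂ) * ((W n : ℂ) * ψ (n + 1)) + (α : ℂ)⁻¹ * ((W' n : ℂ) * ψ (n - 1))) -
    ((α : ℂ) * ((W n : ℂ) * ((V (n + 1) : ℂ) * ψ (n + 1))) +
      (α : ℂ)⁻¹ * ((W' n : ℂ) * ((V (n - 1) : ℂ) * ψ (n - 1)))) =
    -((α : ℂ) * ψ (n + 1) + (α : ℂ)⁻¹ * ψ (n - 1))
  have e1 : ((V n : ℂ) - V (n + 1)) * W n = -1 := by
    have : (V n - V (n + 1)) * W n = -1 := by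
      simp only [W, mul_neg, mul_inv_cancel₀ (hne n)]
    exact_mod_cast this
  have e2 : ((V n : ℂ) - V (n - 1)) * W' n = -1 := by
    have h := hne (n - 1)
    rw [sub_add_cancel] at h
    have : (V n - V (n - 1)) * W' n = -1 := by
      simp only [W']
      rw [← neg_sub, neg_mul, mul_inv_cancel₀ h]
    exact_mod_cast this
  linear_combination (α : ℂ) * ψ (n + 1) * e1 + (α : ℂ)⁻¹ * ψ (n - 1) * e2

/-! ### Exponential weights and matrix elements -/

theorem delta_apply (n m : ℤ) : delta n m = if m = n then (1 : ℂ) else 0 := by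
  simp [delta, Pi.single_apply]

/-- For `α ≠ 1` the weight `α ^ n` is unbounded on `ℓ²(ℤ)`, so the conjugation is done pointwise on
powers applied to `delta n`, then summed in the exponential series. -/
theorem hamiltonian_pow_delta_apply {α : ℝ} (hα : 0 < α) (μ : ℝ) (V : ℤ → ℝ)
    (hb : BddAbove (Set.range fun n => |V n|)) (n : ℤ) (k : ℕ) (m : ℤ) :
    (hamiltonian μ V hb ^ k) (delta n) m = (α : ℂ) ^ (m - n) *
      ((weightedHop α + (μ : ℂ) • potentialOp V hb) ^ k) (delta n) m := by
  have hα' : (α : ℂ) ≠ 0 := by exact_mod_cast hα.ne'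
  induction k generalizing m with
  | zero =>
    simp only [pow_zero, one_apply_eq_self, delta_apply]
    split_ifs with h <;> simp [h]
  | succ k ih =>
    rw [pow_succ', pow_succ', mul_apply_eq_comp, mul_apply_eq_comp,
      hamiltonian_apply, ih, ih, ih]
    set φ := ((weightedHop α + (μ : ℂ) • potentialOp V hb) ^ k) (delta n)
    change _ = (α : ℂ) ^ (m - n) * ((α : ℂ) * φ (m + 1) + (α : ℂ)⁻¹ * φ (m - 1) +
      (μ : ℂ) * ((V m : ℂ) * φ m))
    rw [show m + 1 - n = m - n + 1 by ring, show m - 1 - n = m - n - 1 by ring,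
      zpow_add_one₀ hα', zpow_sub_one₀ hα']
    ring

theorem hasSum_inner_exp_smul (c : ℂ) (H : L2Z →L[ℂ] L2Z) (m n : ℤ) :
    HasSum (fun k : ℕ => ((k.factorial : ℂ))⁻¹ * (c ^ k * (H ^ k) (delta n) m))
      (inner ℂ (delta m) (NormedSpace.exp (c • H) (delta n))) := by
  have h := (NormedSpace.exp_series_hasSum_exp' (𝕂 := ℂ) (c • H)).mapL
    ((innerSL ℂ (delta m)).comp (ContinuousLinearMap.apply ℂ L2Z (delta n)))
  refine (congrArg (HasSum · _) (funext fun k => ?_)).mpr h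
  simp [smul_pow, delta, lp.inner_single_left]

theorem inner_evolution_delta {α : ℝ} (hα : 0 < α) (μ : ℝ) (V : ℤ → ℝ)
    (hb : BddAbove (Set.range fun n => |V n|)) (t : ℝ) (m n : ℤ) :
    inner ℂ (delta m) (evolution (hamiltonian μ V hb) t (delta n)) = (α : ℂ) ^ (m - n) *
      inner ℂ (delta m) (evolution (weightedHop α + (μ : ℂ) • potentialOp V hb) t (delta n)) := by
  refine (hasSum_inner_exp_smul _ _ m n).unique ?_
  refine (congrArg (HasSum · _) (funext fun k => ?_)).mpr
    ((hasSum_inner_exp_smul _ _ m n).mul_left ((α : ℂ) ^ (m - n)))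
  rw [hamiltonian_pow_delta_apply hα]
  ring

theorem norm_delta (n : ℤ) : ‖delta n‖ = 1 := by
  simp [delta, lp.norm_single]

theorem norm_inner_delta_le (T : L2Z →L[ℂ] L2Z) (m n : ℤ) :
    ‖inner ℂ (delta m) (T (delta n))‖ ≤ ‖T‖ := by
  refine (norm_inner_le_norm _ _).trans ?_
  have := T.le_opNorm (delta n)
  rwa [norm_delta, one_mul, ← mul_one ‖T‖, ← norm_delta n]

/-! ### Block norms, explicit constants and decay -/

theorem matrixOpNorm_le {p : ℕ} (M : Matrix (Fin p) (Fin p) ℂ) {c : ℝ} (hc : 0 ≤ c)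
    (h : ∀ i j, ‖M i j‖ ≤ c) : matrixOpNorm M ≤ p ^ 2 * c := by
  refine ContinuousLinearMap.opNorm_le_bound _ (by positivity) fun x => ?_
  have h1 : ∀ i, ‖Matrix.toEuclideanCLM (n := Fin p) (𝕜 := ℂ) M x i‖ ≤ p * (c * ‖x‖) := fun i => by
    have : Matrix.toEuclideanCLM (n := Fin p) (𝕜 := ℂ) M x i = ∑ j, M i j * x j := rfl
    rw [this]
    refine (norm_sum_le _ _).trans ((Finset.sum_le_card_nsmul _ _ (c * ‖x‖) fun j _ => ?_).trans ?_)
    · rw [norm_mul]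
      exact mul_le_mul (h i j) (PiLp.norm_apply_le x j) (norm_nonneg _) hc
    · simp
  have h2 : ‖Matrix.toEuclideanCLM (n := Fin p) (𝕜 := ℂ) M x‖ ≤
      ∑ i, ‖Matrix.toEuclideanCLM (n := Fin p) (𝕜 := ℂ) M x i‖ := by
    rw [EuclideanSpace.norm_eq]
    refine Real.sqrt_le_iff.2 ⟨by positivity, ?_⟩
    exact Finset.sum_sq_le_sq_sum_of_nonneg fun i _ => norm_nonneg _
  refine h2.trans ((Finset.sum_le_card_nsmul _ _ _ fun i _ => h1 i).trans (le_of_eq ?_))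
  simp
  ring

/-- Links the hopping norm at weight `e^{η₀/p}` to `hatC`; it serves both the smallness condition on
`1/μ` and the velocity. -/
theorem sq_hop_le_hatC {p : ℕ} (hp : 2 ≤ p) {η₀ γ Γ : ℝ} (hη₀ : 0 < η₀) (hγ : 0 < γ) (hΓ : γ ≤ Γ) :
    5 * (Real.exp (η₀ / p) + (Real.exp (η₀ / p))⁻¹) ^ 2 ≤
      6 * (hatC η₀ γ Γ p * (2 / γ) ^ (p - 2)) := by
  obtain ⟨q, rfl⟩ := Nat.exists_eq_add_of_le' hp
  simp only [Nat.add_sub_cancel]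
  set E := Real.exp (η₀ / (q + 2 : ℕ)) with hE
  have hEp : Real.exp η₀ = E ^ (q + 2) := by
    rw [hE, ← Real.exp_nat_mul]
    congr 1
    field_simp
  have hE1 : 1 ≤ E := Real.one_le_exp (by positivity)
  have hEi : E⁻¹ ≤ 1 := inv_le_one_of_one_le₀ hE1
  have hE0 : 0 < E := by linarith
  have hΓ0 : 0 < Γ := by linarith
  rw [hatC, hEp, Nat.add_sub_cancel]
  rcases Nat.eq_zero_or_pos q with rfl | hq
  · have : (0 : ℝ) ≤ 2 ^ 2 * (Γ + γ / 2) ^ 2 := by positivity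
    have h2 : (E + E⁻¹) ^ 2 = E ^ 2 + 2 + (E⁻¹) ^ 2 := by field_simp; ring
    have h3 : 1 / (2 * E ^ 2) = (E⁻¹) ^ 2 / 2 := by field_simp
    simp only [zero_add, pow_zero, mul_one]
    rw [h2, h3]
    nlinarith
  · have h1 : (3 * γ) ^ (q + 2) ≤ 2 ^ (q + 2) * (Γ + γ / 2) ^ (q + 2) := by
      rw [← mul_pow]
      exact pow_le_pow_left₀ (by positivity) (by linarith) _
    -- A mixed monomial is at most the pure power of the larger factor; the two pure powers are
    -- controlled by the first and third terms of `hatC`.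
    have h2 : (3 * γ) ^ q * E ^ 2 ≤ (3 * γ) ^ (q + 2) + E ^ (q + 2) := by
      have := pow_pos hE0 (q + 2)
      rcases le_total E (3 * γ) with h | h
      · have : (3 * γ) ^ q * E ^ 2 ≤ (3 * γ) ^ q * (3 * γ) ^ 2 := by gcongr
        rw [pow_add]
        linarith
      · have : (3 * γ) ^ q * E ^ 2 ≤ E ^ q * E ^ 2 := by gcongr
        have : 0 < (3 * γ) ^ (q + 2) := by positivity
        rw [pow_add E]
        linarith
    have h3 : 6 * E ^ 2 ≤ (3 * γ) ^ q * E ^ 2 * (2 / γ) ^ q := by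
      have : (3 * γ) ^ q * E ^ 2 * (2 / γ) ^ q = 6 ^ q * E ^ 2 := by
        rw [mul_right_comm, ← mul_pow]
        congr 2
        field_simp
        norm_num
      rw [this]
      gcongr
      exact le_self_pow₀ (by norm_num) hq.ne'
    have h4 : (3 * γ) ^ q * E ^ 2 ≤ 2 ^ (q + 2) * (Γ + γ / 2) ^ (q + 2) + (Γ + γ / 2 + 2) ^ q +
        2 * E ^ (q + 2) + 1 / (2 * E ^ (q + 2)) := by
      have : 0 ≤ (Γ + γ / 2 + 2) ^ q := by positivity
      have : 0 ≤ 1 / (2 * E ^ (q + 2)) := by positivity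
      have : 0 ≤ E ^ (q + 2) := by positivity
      linarith
    have h5 := h3.trans (mul_le_mul_of_nonneg_right h4 (by positivity : 0 ≤ (2 / γ) ^ q))
    have h6 : (E + E⁻¹) ^ 2 ≤ (2 * E) ^ 2 := by
      gcongr
      linarith
    nlinarith

/-- Off-diagonal decay of the matrix elements of the evolution. -/
theorem norm_inner_evolution_le {κ g μ : ℝ} (hμ : 0 < μ) (hg : 0 < g) (V : ℤ → ℝ)
    (hb : BddAbove (Set.range fun n => |V n|)) (hV : ∀ n, g ≤ |V n - V (n + 1)|)
    (hx : (Real.exp κ + (Real.exp κ)⁻¹) / (g * μ) ≤ 2 / 5) (t : ℝ) (m n : ℤ) :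
    ‖inner ℂ (delta m) (evolution (hamiltonian μ V hb) t (delta n))‖ ≤
      7 / 3 * Real.exp (5 / 3 * ((Real.exp κ + (Real.exp κ)⁻¹) ^ 2 / (g * μ)) * |t|) *
        Real.exp (-κ * |((m - n : ℤ) : ℝ)|) := by
  -- The hopping bound is invariant under `s ↦ -s`, so the sign can be chosen to make the weight
  -- decay for the given `m - n`.
  have key : ∀ s : ℝ, Real.exp s + (Real.exp s)⁻¹ = Real.exp κ + (Real.exp κ)⁻¹ →
      s * ((m - n : ℤ) : ℝ) = -κ * |((m - n : ℤ) : ℝ)| → ‖inner ℂ (delta m)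
        (evolution (hamiltonian μ V hb) t (delta n))‖ ≤
      7 / 3 * Real.exp (5 / 3 * ((Real.exp κ + (Real.exp κ)⁻¹) ^ 2 / (g * μ)) * |t|) *
        Real.exp (-κ * |((m - n : ℤ) : ℝ)|) := fun s hs hsm => by
    have hα := Real.exp_pos s
    obtain ⟨X, hX, hDX⟩ := exists_commutator_eq_neg_weightedHop hα hg V hb hV
    rw [inner_evolution_delta hα, norm_mul, norm_zpow, Complex.norm_real,
      Real.norm_of_nonneg hα.le, ← Real.rpow_intCast, ← Real.exp_mul, hsm, mul_comm, ← hs]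
    refine mul_le_mul_of_nonneg_right ((norm_inner_delta_le _ m n).trans ?_) (Real.exp_pos _).le
    exact norm_exp_le_of_commutator hμ hg (potentialOp_isSymmetric V hb) hDX (norm_weightedHop_le hα) hX
      (hs ▸ hx) t
  rcases le_total 0 ((m - n : ℤ) : ℝ) with h | h
  · refine key (-κ) ?_ (by rw [abs_of_nonneg h])
    rw [Real.exp_neg, inv_inv, add_comm]
  · exact key κ rfl (by rw [abs_of_nonpos h, neg_mul_neg])

/-- The positions inside the two blocks shift the distance by at most `p`; at decay rate `η₀ / p`
this costs a factor `e^{η₀}`. -/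
theorem abs_sub_le_block_distance {p : ℕ} (j k : ℤ) (m n : Fin p) :
    (p : ℝ) * |(j : ℝ) - k| - p ≤ |((p * j + (m : ℕ) - (p * k + (n : ℕ)) : ℤ) : ℝ)| := by
  have hm : ((m : ℕ) : ℝ) ≤ p := by exact_mod_cast m.2.le
  have hn : ((n : ℕ) : ℝ) ≤ p := by exact_mod_cast n.2.le
  have hm0 : (0 : ℝ) ≤ (m : ℕ) := by positivity
  have hn0 : (0 : ℝ) ≤ (n : ℕ) := by positivity
  have hmn : |((n : ℕ) : ℝ) - (m : ℕ)| ≤ p := abs_le.2 ⟨by linarith, by linarith⟩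
  have h : (p : ℝ) * |(j : ℝ) - k| = |(p : ℝ) * j - p * k| := by
    rw [← mul_sub, abs_mul, Nat.abs_cast]
  push_cast
  rw [h]
  have := abs_add_le ((p : ℝ) * j + (m : ℕ) - (p * k + (n : ℕ))) ((n : ℕ) - (m : ℕ))
  rw [show (p : ℝ) * j + (m : ℕ) - (p * k + (n : ℕ)) + ((n : ℕ) - (m : ℕ)) = p * j - p * k by ring]
    at this
  linarith

end LiebRobinson

theorem theorem1 (p : ℕ) (hp : 2 ≤ p) (γ Γ : ℝ) (hγ : 0 < γ) (η₀ : ℝ) (hη₀ : 0 < η₀) :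
    ∃ C₁ C₂ μ₀ : ℝ, 0 < C₁ ∧
      C₂ = LiebRobinson.hatC η₀ γ Γ p / (η₀ * (γ / 2) ^ (p - 1)) ∧
      μ₀ = Real.sqrt (max 1 (2 * LiebRobinson.hatC η₀ γ Γ p * (2 / γ) ^ p)) ∧
      ∀ (V : ℤ → ℝ) (hV : Function.Periodic V (p : ℤ)),
        IsLeast (LiebRobinson.distances p V) γ → IsGreatest (LiebRobinson.distances p V) Γ →
        ∀ μ : ℝ, μ₀ ≤ μ → ∀ (t : ℝ) (j k : ℤ),
          LiebRobinson.matrixOpNorm (LiebRobinson.block p (LiebRobinson.evolution (LiebRobinson.hamiltonian μ V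
              (LiebRobinson.bddAbove_of_periodic (Nat.lt_of_lt_of_le Nat.two_pos hp) hV)) t) j k) ≤
            C₁ * Real.exp (-η₀ * (|(j : ℝ) - (k : ℝ)| - C₂ / μ * |t|)) := by
  -- `p ^ 2` passes from entries to the block norm, `7 / 3 = 7/5 * 5/3` bounds the similarity and
  -- its inverse, and `e^{η₀}` absorbs the positions inside blocks.
  refine ⟨p ^ 2 * (7 / 3 * Real.exp η₀), _, _, by positivity, rfl, rfl, ?_⟩
  intro V hV hleast hgreatest μ hμ t j k
  have hp0 : (0 : ℝ) < p := by positivity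
  have hΓ : γ ≤ Γ := hgreatest.2 hleast.1
  have hμ1 : 1 ≤ μ := (Real.one_le_sqrt.2 (le_max_left _ _)).trans hμ
  have hμ0 : 0 < μ := by linarith
  have hstep : ∀ n, γ ≤ |V n - V (n + 1)| := fun n =>
    hleast.2 ⟨n, n + 1, by simp, by simp; omega, rfl⟩
  have hQ := LiebRobinson.sq_hop_le_hatC hp hη₀ hγ hΓ
  set a := Real.exp (η₀ / p) + (Real.exp (η₀ / p))⁻¹ with ha
  set C := LiebRobinson.hatC η₀ γ Γ p
  set R := C * (2 / γ) ^ (p - 2) with hR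
  have ha0 : 0 < a := by positivity
  have hμsq : 8 * R ≤ (γ * μ) ^ 2 := by
    have h1 : 2 * C * (2 / γ) ^ p ≤ μ ^ 2 :=
      (le_max_right _ _).trans ((Real.sqrt_le_left hμ0.le).1 hμ)
    have h2 : 2 * C * (2 / γ) ^ p = 8 * R / γ ^ 2 := by
      rw [hR, ← Nat.sub_add_cancel hp, pow_add, Nat.add_sub_cancel]
      ring
    rw [h2, div_le_iff₀ (by positivity)] at h1
    linarith [mul_pow γ μ 2]
  -- From `5 a² ≤ 6 R` and `8 R ≤ (γ μ)²`: `a² ≤ (3/20)(γ μ)²`, and `3/20 < 4/25`.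
  have hx : a / (γ * μ) ≤ 2 / 5 := by
    rw [div_le_iff₀ (by positivity)]
    refine (sq_le_sq₀ ha0.le (by positivity)).1 ?_
    nlinarith
  have hrate : 5 / 3 * (a ^ 2 / (γ * μ)) ≤ η₀ * (C / (η₀ * (γ / 2) ^ (p - 1)) / μ) := by
    have h1 : η₀ * (C / (η₀ * (γ / 2) ^ (p - 1)) / μ) = 2 * R / (γ * μ) := by
      rw [hR, show p - 1 = p - 2 + 1 by omega, pow_succ, div_pow, div_pow]
      field_simp
    rw [h1, ← mul_div_assoc]
    exact div_le_div_of_nonneg_right (by linarith) (by positivity)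
  refine (LiebRobinson.matrixOpNorm_le _ (c := 7 / 3 * Real.exp η₀ *
    Real.exp (-η₀ * (|(j : ℝ) - (k : ℝ)| - C / (η₀ * (γ / 2) ^ (p - 1)) / μ * |t|)))
    (by positivity) fun m n => ?_).trans (le_of_eq (by ring))
  refine (LiebRobinson.norm_inner_evolution_le hμ0 hγ V _ hstep hx t _ _).trans ?_
  rw [mul_assoc (7 / 3), mul_assoc (7 / 3), ← Real.exp_add, ← Real.exp_add]
  refine mul_le_mul_of_nonneg_left (Real.exp_le_exp.2 ?_) (by norm_num)
  have h1 := mul_le_mul_of_nonneg_right hrate (abs_nonneg t)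
  have h2 := mul_le_mul_of_nonneg_left (LiebRobinson.abs_sub_le_block_distance j k m n)
    (by positivity : 0 ≤ η₀ / p)
  have h3 : η₀ / p * ((p : ℝ) * |(j : ℝ) - k| - p) = η₀ * |(j : ℝ) - k| - η₀ := by
    field_simp
  linarith
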